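/- Let $p,e>2$ be primes, let $\mathbb{F}_{p^e}$ be the field with $p^e$ elements, and let $$H=\left\{\begin{bmatrix}1&\alpha&\gamma\\0&1&\beta\\0&0&1\end{bmatrix}:\alpha,\beta,\gamma\in\mathbb{F}_{p^e}\right\}$$ be the Heisenberg group over $\mathbb{F}_{p^e}$ under matrix multiplication, with commutator subgroup $H'=[H,H]$. Every subgroup of the central subgroup $H'$ is normal in $H$, so the quotients below are groups; put $$\mathcal{G}_{p,e}=\{H/N : N\leq H',\ |H:N|=p^{2e+2}\}.$$ Then the groups in $\mathcal{G}_{p,e}$ fall into at least $p^{e-3}/e$ isomorphism classes. -/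

import Mathlib

open scoped commutatorElement

/-- The Heisenberg group `H(F)` of upper unitriangular `3 × 3` matrices over a field `F`,
as a subgroup of `SL₃(F)`. -/
def heisenberg (F : Type*) [Field F] : Subgroup (Matrix.SpecialLinearGroup (Fin 3) F) where
  carrier := {A | ∃ α β γ : F, (A : Matrix (Fin 3) (Fin 3) F) = !![1, α, γ; 0, 1, β; 0, 0, 1]}
  one_mem' := ⟨0, 0, 0, by
    ext i j; fin_cases i <;> fin_cases j <;> simp⟩
  mul_mem' := by
    rintro A B ⟨α, β, γ, hA⟩ ⟨α', β', γ', hB⟩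
    refine ⟨α + α', β + β', γ + α * β' + γ', ?_⟩
    rw [Matrix.SpecialLinearGroup.coe_mul, hA, hB]
    ext i j
    fin_cases i <;> fin_cases j <;> simp [Matrix.mul_apply, Fin.sum_univ_three] <;> ring
  inv_mem' := by
    rintro A ⟨α, β, γ, hA⟩
    refine ⟨-α, -β, α * β - γ, ?_⟩
    rw [Matrix.SpecialLinearGroup.coe_inv, hA, Matrix.adjugate_fin_three]
    ext i j
    fin_cases i <;> fin_cases j <;> simp

/-- The commutator subgroup `H'` of the Heisenberg group is central. -/
theorem heisenberg_commutator_le_center (F : Type*) [Field F] :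
    commutator (heisenberg F) ≤ Subgroup.center (heisenberg F) := by
  refine Subgroup.commutator_le.mpr ?_
  rintro ⟨A, hA⟩ - ⟨B, hB⟩ -
  obtain ⟨α, β, γ, hA'⟩ := id hA
  obtain ⟨α', β', γ', hB'⟩ := id hB
  let z : heisenberg F :=
    ⟨⟨!![1, 0, α * β' - α' * β; 0, 1, 0; 0, 0, 1], by simp [Matrix.det_fin_three]⟩,
      0, 0, α * β' - α' * β, rfl⟩
  have hz : ⁅(⟨A, hA⟩ : heisenberg F), (⟨B, hB⟩ : heisenberg F)⁆ = z := by
    rw [commutatorElement_def, mul_inv_eq_iff_eq_mul, mul_inv_eq_iff_eq_mul]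
    apply Subtype.ext
    apply Subtype.ext
    change (A : Matrix (Fin 3) (Fin 3) F) * (B : Matrix (Fin 3) (Fin 3) F) =
      !![1, 0, α * β' - α' * β; 0, 1, 0; 0, 0, 1] * (B : Matrix (Fin 3) (Fin 3) F) *
        (A : Matrix (Fin 3) (Fin 3) F)
    rw [hA', hB']
    ext i j
    fin_cases i <;> fin_cases j <;> simp [Matrix.mul_apply, Fin.sum_univ_three] <;> ring
  rw [hz, Subgroup.mem_center_iff]
  rintro ⟨C, a, b, c, hC⟩
  apply Subtype.ext
  apply Subtype.ext
  change (C : Matrix (Fin 3) (Fin 3) F) * !![1, 0, α * β' - α' * β; 0, 1, 0; 0, 0, 1] =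
    !![1, 0, α * β' - α' * β; 0, 1, 0; 0, 0, 1] * (C : Matrix (Fin 3) (Fin 3) F)
  rw [hC]
  ext i j
  fin_cases i <;> fin_cases j <;> simp [Matrix.mul_apply, Fin.sum_univ_three] <;> ring

/-- The subgroups `N ≤ H'` of index `p ^ (2 * e + 2)` in `H = H(𝔽_{p^e})`.  They index the set
`𝒢_{p,e} = {H/N : N ≤ H', |H : N| = p ^ (2 * e + 2)}`. -/
structure HeisenbergKernel (p e : ℕ) [Fact p.Prime] where
  /-- The subgroup `N` of `H`. -/
  N : Subgroup (heisenberg (GaloisField p e))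
  le_commutator : N ≤ commutator (heisenberg (GaloisField p e))
  index_eq : N.index = p ^ (2 * e + 2)

instance HeisenbergKernel.normal {p e : ℕ} [Fact p.Prime] (K : HeisenbergKernel p e) :
    K.N.Normal where
  conj_mem n hn g := by
    have h := Subgroup.mem_center_iff.mp
      (heisenberg_commutator_le_center _ (K.le_commutator hn)) g
    rwa [h, mul_inv_cancel_right]

/-- The group `H/N`, a member of `𝒢_{p,e}`. -/
abbrev HeisenbergKernel.Quot {p e : ℕ} [Fact p.Prime] (K : HeisenbergKernel p e) : Type :=
  heisenberg (GaloisField p e) ⧸ K.N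

/-- Two members of `𝒢_{p,e}` have the same isomorphism type when they are isomorphic groups. -/
def heisenbergQuotientSetoid (p e : ℕ) [Fact p.Prime] : Setoid (HeisenbergKernel p e) where
  r K L := Nonempty (K.Quot ≃* L.Quot)
  iseqv :=
    { refl := fun K => ⟨MulEquiv.refl K.Quot⟩
      symm := fun ⟨f⟩ => ⟨f.symm⟩
      trans := fun ⟨f⟩ ⟨g⟩ => ⟨f.trans g⟩ }

/-- The number of isomorphism types of groups in `𝒢_{p,e}`. -/
noncomputable def numIsoTypes (p e : ℕ) [Fact p.Prime] : ℕ :=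
  Nat.card (Quotient (heisenbergQuotientSetoid p e))

/-! For `t` outside the prime field, the trace-orthogonal complement of the span of `1` and `t` has
codimension 2 in `F`, so its image in the centre is an admissible `N`. The commutator on `H/N` then
encodes the pencil of forms `tr (a * symp u v)` with `a` in that span. An isomorphism from the
quotient for `s` to the one for `t` pulls the forms for `1` and `t` back to those for some `m₀`,
`m₁` in the span of `1` and `s`. The induced map on `F × F` therefore intertwines multiplication by
`m₁ / m₀` with multiplication by `t`, so the two scalars are conjugate (`exists_minpoly_div_eq`).
Inverting the quotient makes `s` a fractional linear transform of a conjugate of `t`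
(`exists_fracLin_eq`). Each isomorphism class thus contains at most `e * (p ^ 3 - p)` of the `p ^ e
- p` parameters. -/

namespace Heisenberg

/-! ### Coordinates, commutators and maps induced by isomorphisms of quotients. -/

variable {F : Type*} [Field F]

/-- The upper unitriangular matrix with entries `a`, `b` next to the diagonal and `c` in the
corner. -/
def mk (a b c : F) : heisenberg F :=
  ⟨⟨!![1, a, c; 0, 1, b; 0, 0, 1], by simp [Matrix.det_fin_three]⟩, a, b, c, rfl⟩

theorem exists_eq_mk (h : heisenberg F) : ∃ a b c, h = mk a b c := by
  obtain ⟨A, a, b, c, hA⟩ := h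
  exact ⟨a, b, c, Subtype.ext (Subtype.ext hA)⟩

theorem mk_mul_mk (a b c a' b' c' : F) :
    mk a b c * mk a' b' c' = mk (a + a') (b + b') (c + a * b' + c') := by
  apply Subtype.ext
  apply Subtype.ext
  change !![1, a, c; 0, 1, b; 0, 0, 1] * !![1, a', c'; 0, 1, b'; 0, 0, 1] =
    !![1, a + a', c + a * b' + c'; 0, 1, b + b'; 0, 0, 1]
  ext i j
  fin_cases i <;> fin_cases j <;> simp [Matrix.mul_apply, Fin.sum_univ_three] <;> ring

theorem mk_inj {a b c a' b' c' : F} : mk a b c = mk a' b' c' ↔ a = a' ∧ b = b' ∧ c = c' := by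
  refine ⟨fun h => ?_, by rintro ⟨rfl, rfl, rfl⟩; rfl⟩
  have h' (i j) := congrArg (fun g : heisenberg F => (g : Matrix.SpecialLinearGroup (Fin 3) F) i j) h
  exact ⟨h' 0 1, h' 1 2, h' 0 2⟩

/-- The Heisenberg group over `F` is in bijection with `F × F × F`. -/
noncomputable def equivProd (F : Type*) [Field F] : heisenberg F ≃ F × F × F :=
  (Equiv.ofBijective (fun x : F × F × F => mk x.1 x.2.1 x.2.2)
    ⟨fun x y h => by
      obtain ⟨h₁, h₂, h₃⟩ := mk_inj.mp h
      exact Prod.ext h₁ (Prod.ext h₂ h₃),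
    fun h => by
      obtain ⟨a, b, c, rfl⟩ := exists_eq_mk h
      exact ⟨(a, b, c), rfl⟩⟩).symm

/-- The projection of the Heisenberg group onto its abelianization `F × F`. -/
def toProd (F : Type*) [Field F] : heisenberg F →* Multiplicative (F × F) :=
  MonoidHom.mk' (fun h => Multiplicative.ofAdd
    ((h : Matrix.SpecialLinearGroup (Fin 3) F) 0 1, (h : Matrix.SpecialLinearGroup (Fin 3) F) 1 2))
    fun g h => by
      obtain ⟨a, b, c, rfl⟩ := exists_eq_mk g
      obtain ⟨a', b', c', rfl⟩ := exists_eq_mk h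
      rw [mk_mul_mk]
      rfl

theorem toProd_mk (a b c : F) : toProd F (mk a b c) = Multiplicative.ofAdd (a, b) := rfl

/-- The embedding of `F` as the commutator subgroup of the Heisenberg group. -/
def corner (F : Type*) [Field F] : Multiplicative F →* heisenberg F :=
  MonoidHom.mk' (fun c => mk 0 0 c.toAdd) fun c d => by simp [mk_mul_mk]

theorem corner_apply (c : Multiplicative F) : corner F c = mk 0 0 c.toAdd := rfl

theorem corner_injective : Function.Injective (corner F) :=
  fun _ _ h => (mk_inj.mp h).2.2

/-- The standard symplectic form on `F × F`. -/
def symp (u v : F × F) : F := u.1 * v.2 - v.1 * u.2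

theorem commutator_eq (g h : heisenberg F) :
    ⁅g, h⁆ = corner F (.ofAdd (symp (toProd F g).toAdd (toProd F h).toAdd)) := by
  obtain ⟨a, b, c, rfl⟩ := exists_eq_mk g
  obtain ⟨a', b', c', rfl⟩ := exists_eq_mk h
  rw [commutatorElement_def, mul_inv_eq_iff_eq_mul, mul_inv_eq_iff_eq_mul]
  simp only [corner_apply, toProd_mk, mk_mul_mk, mk_inj, symp, toAdd_ofAdd]
  refine ⟨by ring, by ring, by ring⟩

theorem range_corner_le_commutator : (corner F).range ≤ commutator (heisenberg F) := by
  rintro _ ⟨c, rfl⟩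
  have h := commutator_eq (mk (c.toAdd) 0 0) (mk 0 1 0)
  have h' : ⁅mk (c.toAdd) 0 0, mk 0 1 0⁆ = corner F c := by
    rw [h]
    simp [toProd_mk, symp]
  rw [← h']
  exact Subgroup.commutator_mem_commutator (Subgroup.mem_top _) (Subgroup.mem_top _)

theorem commutator_le_ker_toProd : commutator (heisenberg F) ≤ (toProd F).ker :=
  Abelianization.commutator_subset_ker _

theorem ker_toProd : (toProd F).ker = (corner F).range := by
  ext h
  obtain ⟨a, b, c, rfl⟩ := exists_eq_mk h
  simp only [MonoidHom.mem_ker, toProd_mk, MonoidHom.mem_range, corner_apply, mk_inj]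
  rw [← ofAdd_zero, Multiplicative.ofAdd.injective.eq_iff, Prod.mk_eq_zero]
  refine ⟨?_, ?_⟩
  · rintro ⟨rfl, rfl⟩
    exact ⟨.ofAdd c, rfl, rfl, rfl⟩
  · rintro ⟨_, rfl, rfl, -⟩
    exact ⟨rfl, rfl⟩

/-- An additive subgroup of `F` as a subgroup of the commutator subgroup of the Heisenberg
group. -/
def cornerSubgroup (S : AddSubgroup F) : Subgroup (heisenberg F) :=
  (AddSubgroup.toSubgroup S).map (corner F)

theorem cornerSubgroup_le_commutator (S : AddSubgroup F) :
    cornerSubgroup S ≤ commutator (heisenberg F) :=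
  (Subgroup.map_le_range _ _).trans range_corner_le_commutator

theorem corner_mem_cornerSubgroup {S : AddSubgroup F} {c : F} :
    corner F (.ofAdd c) ∈ cornerSubgroup S ↔ c ∈ S :=
  Subgroup.mem_map_iff_mem corner_injective

theorem card_cornerSubgroup (S : AddSubgroup F) : Nat.card (cornerSubgroup S) = Nat.card S :=
  Subgroup.card_map_of_injective corner_injective

/-- An isomorphism between quotients of the Heisenberg group by subgroups of its commutator
subgroup induces maps on `F × F` and on `F`, compatible with the symplectic form. -/
theorem exists_maps_of_mulEquiv {S T : AddSubgroup F} [(cornerSubgroup S).Normal]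
    [(cornerSubgroup T).Normal]
    (f : heisenberg F ⧸ cornerSubgroup S ≃* heisenberg F ⧸ cornerSubgroup T) :
    ∃ (φ : F × F →+ F × F) (χ : F → F), Function.Surjective φ ∧
      (∀ x y, χ (x + y) - (χ x + χ y) ∈ T) ∧ (∀ x ∈ S, χ x ∈ T) ∧
      ∀ u v, χ (symp u v) - symp (φ u) (φ v) ∈ T := by
  let q : heisenberg F ⧸ cornerSubgroup T →* Multiplicative (F × F) :=
    QuotientGroup.lift _ (toProd F) fun x hx =>
      commutator_le_ker_toProd (cornerSubgroup_le_commutator T hx)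
  let g : heisenberg F →* Multiplicative (F × F) :=
    (q.comp f.toMonoidHom).comp (QuotientGroup.mk' (cornerSubgroup S))
  -- The target is abelian, so `g` kills the corner, which consists of commutators.
  have hg (a b c) : g (mk a b c) = g (mk a b 0) := by
    have h : mk a b c = corner F (.ofAdd c) * mk a b 0 := by
      simp [corner_apply, mk_mul_mk]
    have hc : g (corner F (.ofAdd c)) = 1 :=
      Abelianization.commutator_subset_ker g (range_corner_le_commutator ⟨_, rfl⟩)
    rw [h, map_mul, hc, one_mul]
  let φ : F × F →+ F × F := AddMonoidHom.mk' (fun u => (g (mk u.1 u.2 0)).toAdd) fun u v => by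
    rw [← toAdd_mul, ← map_mul, mk_mul_mk, hg _ _ (0 + _ + 0)]
    rfl
  have hφ (h) : φ (toProd F h).toAdd = (g h).toAdd := by
    obtain ⟨a, b, c, rfl⟩ := exists_eq_mk h
    rw [hg]
    rfl
  have hsurj : Function.Surjective φ := by
    intro w
    obtain ⟨y, hy⟩ := QuotientGroup.mk_surjective (f.symm (mk w.1 w.2 0 : heisenberg F))
    refine ⟨(toProd F y).toAdd, ?_⟩
    rw [hφ]
    change (q (f y)).toAdd = w
    rw [hy, f.apply_symm_apply]
    rfl
  have hχ (c : F) : ∃ d : F, f (corner F (.ofAdd c) : heisenberg F) =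
      (corner F (.ofAdd d) : heisenberg F) := by
    obtain ⟨y, hy⟩ := QuotientGroup.mk_surjective (f (corner F (.ofAdd c) : heisenberg F))
    have h1 : y ∈ (toProd F).ker := by
      have h2 : g (corner F (.ofAdd c)) = 1 :=
        Abelianization.commutator_subset_ker g (range_corner_le_commutator ⟨_, rfl⟩)
      change q (f (corner F (.ofAdd c) : heisenberg F)) = 1 at h2
      rw [← hy] at h2
      exact h2
    rw [ker_toProd] at h1
    obtain ⟨d, rfl⟩ := h1
    exact ⟨d.toAdd, hy.symm⟩
  -- The lift `χ` is arbitrary, hence additive only modulo `T`.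
  choose χ hχ using hχ
  have hmk {x y : F} (h : ((corner F (.ofAdd x) : heisenberg F) : heisenberg F ⧸ cornerSubgroup T) =
      (corner F (.ofAdd y) : heisenberg F)) : y - x ∈ T := by
    rw [QuotientGroup.eq, ← map_inv, ← map_mul] at h
    have h' := corner_mem_cornerSubgroup.mp h
    change -x + y ∈ T at h'
    rwa [neg_add_eq_sub] at h'
  refine ⟨φ, χ, hsurj, fun x y => hmk ?_, fun x hx => ?_, fun u v => hmk ?_⟩
  · rw [ofAdd_add, map_mul, QuotientGroup.mk_mul, ← hχ, ← hχ, ← map_mul, ← QuotientGroup.mk_mul,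
      ← map_mul, ← ofAdd_add, hχ]
  · rw [← corner_mem_cornerSubgroup, ← QuotientGroup.eq_one_iff, ← hχ,
      (QuotientGroup.eq_one_iff _).mpr (corner_mem_cornerSubgroup.mpr hx), map_one]
  · obtain ⟨y, hy⟩ := QuotientGroup.mk_surjective (f (mk u.1 u.2 0 : heisenberg F))
    obtain ⟨z, hz⟩ := QuotientGroup.mk_surjective (f (mk v.1 v.2 0 : heisenberg F))
    have hy' : (toProd F y).toAdd = φ u := by
      change (q y).toAdd = (q (f _)).toAdd
      rw [hy]; rfl
    have hz' : (toProd F z).toAdd = φ v := by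
      change (q z).toAdd = (q (f _)).toAdd
      rw [hz]; rfl
    have h1 := commutator_eq y z
    have h2 := commutator_eq (mk u.1 u.2 0) (mk v.1 v.2 0)
    rw [hy', hz'] at h1
    simp only [toProd_mk, toAdd_ofAdd] at h2
    rw [← h1, ← hχ, ← h2]
    simp only [commutatorElement_def, QuotientGroup.mk_mul, QuotientGroup.mk_inv, map_mul, map_inv,
      hy, hz]

end Heisenberg

namespace Heisenberg

/-! ### Trace duality and equivalence of symplectic pencils. -/

variable {p : ℕ} [Fact p.Prime] {K : Type*} [Field K] [Algebra (ZMod p) K]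

/-- The orthogonal complement of the span of `1` and `t` for the trace form. -/
noncomputable def tracePerp (p : ℕ) [Fact p.Prime] {K : Type*} [Field K] [Algebra (ZMod p) K]
    (t : K) : Submodule (ZMod p) K :=
  (Algebra.traceForm (ZMod p) K).orthogonal (Submodule.span (ZMod p) {1, t})

theorem trace_mul_eq_zero_of_mem_tracePerp {t x a : K} (hx : x ∈ tracePerp p t)
    (ha : a ∈ Submodule.span (ZMod p) {1, t}) : Algebra.trace (ZMod p) K (a * x) = 0 :=
  LinearMap.BilinForm.mem_orthogonal_iff.mp hx a ha

theorem linearIndependent_one_pair {t : K} (ht : t ∉ Set.range (algebraMap (ZMod p) K)) :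
    LinearIndependent (ZMod p) ![1, t] := by
  rw [LinearIndependent.pair_iff]
  intro a b h
  have hb : b = 0 := by
    by_contra hb
    refine ht ⟨-a / b, ?_⟩
    have hb' : algebraMap (ZMod p) K b ≠ 0 := by simpa using hb
    rw [Algebra.smul_def, Algebra.smul_def, mul_one] at h
    rw [map_div₀, map_neg, div_eq_iff hb']
    linear_combination -h
  subst hb
  simpa [Algebra.smul_def] using h

/-- The elements of `K` obtained from `x` by a nonconstant fractional linear transformation,
which is given by `a * x + b` or by `a / (x - d) + b`. -/
noncomputable def fracLin (p : ℕ) [Fact p.Prime] {K : Type*} [Field K] [Algebra (ZMod p) K]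
    (x : K) (g : (ZMod p)ˣ × ZMod p × Option (ZMod p)) : K :=
  algebraMap (ZMod p) K g.1 * (g.2.2.elim x fun d => (x - algebraMap (ZMod p) K d)⁻¹) +
    algebraMap (ZMod p) K g.2.1

/-- With `x = m₁ / m₀ = (a₁ + b₁ s) / (a₀ + b₀ s)`, solving for `s` gives `(a₁ - a₀ x) / (b₀ x -
b₁)`. This is affine in `x` if `b₀ = 0`; otherwise it has its pole at `b₁ / b₀`, and the witnesses
are its partial fractions. -/
theorem exists_fracLin_eq {s m₀ m₁ : K} (hs : s ∉ Set.range (algebraMap (ZMod p) K))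
    (hm₀ : m₀ ∈ Submodule.span (ZMod p) {1, s}) (hm₁ : m₁ ∈ Submodule.span (ZMod p) {1, s})
    (hne : m₀ ≠ 0) (hdiv : m₁ / m₀ ∉ Set.range (algebraMap (ZMod p) K)) :
    ∃ g, fracLin p (m₁ / m₀) g = s := by
  obtain ⟨a₀, b₀, h₀⟩ := Submodule.mem_span_pair.mp hm₀
  obtain ⟨a₁, b₁, h₁⟩ := Submodule.mem_span_pair.mp hm₁
  generalize hx : m₁ / m₀ = x at *
  rw [div_eq_iff hne] at hx
  simp only [Algebra.smul_def, mul_one] at h₀ h₁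
  suffices ∃ (a b : ZMod p) (o : Option (ZMod p)), algebraMap (ZMod p) K a *
      (o.elim x fun d => (x - algebraMap (ZMod p) K d)⁻¹) + algebraMap (ZMod p) K b = s by
    obtain ⟨a, b, o, h⟩ := this
    have ha : a ≠ 0 := by
      rintro rfl
      exact hs ⟨b, by rw [← h]; simp⟩
    exact ⟨(Units.mk0 a ha, b, o), h⟩
  by_cases hb : b₀ = 0
  · subst hb
    rw [map_zero, zero_mul, add_zero] at h₀
    have ha₀ : a₀ ≠ 0 := by
      rintro rfl
      exact hne (by rw [← h₀, map_zero])
    have ha₀' : algebraMap (ZMod p) K a₀ ≠ 0 := by simpa using ha₀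
    have hb₁ : b₁ ≠ 0 := by
      rintro rfl
      refine hdiv ⟨a₁ / a₀, ?_⟩
      rw [map_div₀, div_eq_iff ha₀', h₀, ← hx, ← h₁]
      simp
    have hb₁' : algebraMap (ZMod p) K b₁ ≠ 0 := by simpa using hb₁
    refine ⟨a₀ / b₁, -a₁ / b₁, none, ?_⟩
    simp only [Option.elim, map_div₀, map_neg]
    field_simp
    linear_combination x * h₀ - h₁ - hx
  · have hb' : algebraMap (ZMod p) K b₀ ≠ 0 := by simpa using hb
    refine ⟨(a₁ - a₀ * (b₁ / b₀)) / b₀, -a₀ / b₀, some (b₁ / b₀), ?_⟩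
    have hx' : x - algebraMap (ZMod p) K (b₁ / b₀) ≠ 0 := by
      intro h
      exact hdiv ⟨b₁ / b₀, (sub_eq_zero.mp h).symm⟩
    simp only [Option.elim]
    rw [map_div₀] at hx'
    simp only [map_div₀, map_neg, map_sub, map_mul]
    rw [← div_eq_mul_inv, div_add' _ _ _ hx', div_eq_iff hx']
    field_simp
    linear_combination algebraMap (ZMod p) K b₀ * (h₁ - x * h₀ + hx)

theorem notMem_range_of_minpoly_eq {s t : K} (h : minpoly (ZMod p) s = minpoly (ZMod p) t)
    (ht : t ∉ Set.range (algebraMap (ZMod p) K)) : s ∉ Set.range (algebraMap (ZMod p) K) := by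
  intro hs
  refine ht (minpoly.natDegree_eq_one_iff.mp ?_)
  rw [← h]
  exact minpoly.natDegree_eq_one_iff.mpr hs

variable [FiniteDimensional (ZMod p) K]

theorem eq_zero_of_trace_mul {x : K} (h : ∀ y, Algebra.trace (ZMod p) K (x * y) = 0) : x = 0 :=
  (traceForm_nondegenerate (ZMod p) K).1 x h

theorem mem_span_of_trace_mul {s m : K}
    (h : ∀ x ∈ tracePerp p s, Algebra.trace (ZMod p) K (m * x) = 0) :
    m ∈ Submodule.span (ZMod p) {1, s} := by
  rw [← LinearMap.BilinForm.orthogonal_orthogonal (traceForm_nondegenerate (ZMod p) K)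
    (Algebra.traceForm_isSymm (ZMod p)).isRefl (Submodule.span (ZMod p) {1, s}),
    LinearMap.BilinForm.mem_orthogonal_iff]
  intro x hx
  have := h x hx
  rwa [mul_comm] at this

theorem exists_trace_mul_eq (l : K →ₗ[ZMod p] ZMod p) :
    ∃ m : K, ∀ x, Algebra.trace (ZMod p) K (m * x) = l x := by
  have hn := traceForm_nondegenerate (ZMod p) K
  obtain ⟨m, hm⟩ := (LinearMap.BilinForm.toDual _ hn).surjective l
  exact ⟨m, fun x => by rw [← hm]; rfl⟩

theorem finrank_tracePerp {t : K} (ht : t ∉ Set.range (algebraMap (ZMod p) K)) :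
    Module.finrank (ZMod p) (tracePerp p t) = Module.finrank (ZMod p) K - 2 := by
  have h := finrank_span_eq_card (linearIndependent_one_pair ht)
  rw [Matrix.range_cons_cons_empty, Fintype.card_fin] at h
  rw [tracePerp, LinearMap.BilinForm.finrank_orthogonal (traceForm_nondegenerate (ZMod p) K), h]

/-- Pairing with `a` removes the ambiguity of `χ` modulo `tracePerp p t`, so `tr (a * χ x)` is a
linear functional of `x` and is represented by some `m`. It vanishes on `tracePerp p s`, which puts
`m` in the double complement, the span of `1` and `s`. -/
theorem exists_mem_span_trace_symp {s t : K} {φ : K × K →+ K × K} {χ : K → K}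
    (hadd : ∀ x y, χ (x + y) - (χ x + χ y) ∈ tracePerp p t)
    (hmem : ∀ x ∈ tracePerp p s, χ x ∈ tracePerp p t)
    (hsymp : ∀ u v, χ (symp u v) - symp (φ u) (φ v) ∈ tracePerp p t)
    {a : K} (ha : a ∈ Submodule.span (ZMod p) {1, t}) :
    ∃ m ∈ Submodule.span (ZMod p) {1, s}, ∀ u v,
      Algebra.trace (ZMod p) K (m * symp u v) =
        Algebra.trace (ZMod p) K (a * symp (φ u) (φ v)) := by
  let l : K →+ ZMod p := AddMonoidHom.mk' (fun x => Algebra.trace (ZMod p) K (a * χ x)) fun x y => by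
    have h := trace_mul_eq_zero_of_mem_tracePerp (hadd x y) ha
    rwa [mul_sub, map_sub, mul_add, map_add, sub_eq_zero] at h
  obtain ⟨m, hm⟩ := exists_trace_mul_eq (l.toZModLinearMap p)
  refine ⟨m, mem_span_of_trace_mul fun x hx => ?_, fun u v => ?_⟩
  · rw [hm]
    exact trace_mul_eq_zero_of_mem_tracePerp (hmem x hx) ha
  · rw [hm]
    have h := trace_mul_eq_zero_of_mem_tracePerp (hsymp u v) ha
    rwa [mul_sub, map_sub, sub_eq_zero] at h

/-- If the symplectic pencils attached to `{1, s}` and `{1, t}` are equivalent, then some conjugate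
of `t` is a quotient of two elements of the span of `1` and `s`. -/
theorem exists_minpoly_div_eq {s t : K} {φ : K × K →+ K × K} {χ : K → K}
    (hsurj : Function.Surjective φ)
    (hadd : ∀ x y, χ (x + y) - (χ x + χ y) ∈ tracePerp p t)
    (hmem : ∀ x ∈ tracePerp p s, χ x ∈ tracePerp p t)
    (hsymp : ∀ u v, χ (symp u v) - symp (φ u) (φ v) ∈ tracePerp p t) :
    ∃ m₀ ∈ Submodule.span (ZMod p) {1, s}, ∃ m₁ ∈ Submodule.span (ZMod p) {1, s}, m₀ ≠ 0 ∧
      minpoly (ZMod p) (m₁ / m₀) = minpoly (ZMod p) t := by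
  obtain ⟨m₀, hm₀, h₀⟩ := exists_mem_span_trace_symp hadd hmem hsymp
    (Submodule.subset_span (Set.mem_insert 1 {t}))
  obtain ⟨m₁, hm₁, h₁⟩ := exists_mem_span_trace_symp hadd hmem hsymp
    (Submodule.subset_span (Set.mem_insert_of_mem 1 (Set.mem_singleton t)))
  have hne : m₀ ≠ 0 := by
    rintro rfl
    -- If `m₀ = 0`, the form `tr (symp u v)` would vanish on the image of `φ`, which is everything.
    refine one_ne_zero (eq_zero_of_trace_mul (p := p) (K := K) (x := 1) fun y => ?_)
    obtain ⟨u, hu⟩ := hsurj (y, 0)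
    obtain ⟨v, hv⟩ := hsurj (0, 1)
    have h := h₀ u v
    rw [hu, hv, zero_mul, map_zero] at h
    rw [h]
    simp [symp]
  refine ⟨m₀, hm₀, m₁, hm₁, hne, ?_⟩
  -- A preimage `w` of `t • φ u` satisfies `m₀ * w = m₁ * u` by nondegeneracy of the trace form,
  -- tested on each coordinate axis.
  have key (u : K × K) : φ ((m₁ / m₀) • u) = t • φ u := by
    obtain ⟨w, hw⟩ := hsurj (t • φ u)
    have h (v) : Algebra.trace (ZMod p) K (m₀ * symp w v) =
        Algebra.trace (ZMod p) K (m₁ * symp u v) := by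
      rw [h₀, h₁, hw]
      congr 1
      simp only [symp, Prod.smul_fst, Prod.smul_snd, smul_eq_mul]
      ring
    have hfst : m₀ * w.1 - m₁ * u.1 = 0 := eq_zero_of_trace_mul (p := p) fun y => by
      have h' := h (0, y)
      simp only [symp, zero_mul, sub_zero] at h'
      rw [sub_mul, map_sub, mul_assoc, mul_assoc, h', sub_self]
    have hsnd : m₀ * w.2 - m₁ * u.2 = 0 := eq_zero_of_trace_mul (p := p) fun y => by
      have h' := h (-y, 0)
      simp only [symp, mul_zero, zero_sub, neg_mul, neg_neg] at h'
      rw [sub_mul, map_sub, mul_assoc, mul_assoc, mul_comm w.2, mul_comm u.2, h', sub_self]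
    have hwu : (m₁ / m₀) • u = w := by
      refine Prod.ext ?_ ?_
      · change m₁ / m₀ * u.1 = w.1
        field_simp
        linear_combination -hfst
      · change m₁ / m₀ * u.2 = w.2
        field_simp
        linear_combination -hsnd
    rw [hwu, hw]
  have hsmul (c : ZMod p) (u : K × K) : φ (c • u) = c • φ u := (φ.toZModLinearMap p).map_smul c u
  have hpoly (P : Polynomial (ZMod p)) (u : K × K) :
      φ (Polynomial.aeval (m₁ / m₀) P • u) = Polynomial.aeval t P • φ u := by
    induction P using Polynomial.induction_on' with
    | add P Q hP hQ => simp only [map_add, add_smul, hP, hQ]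
    | monomial n c =>
      simp only [Polynomial.aeval_monomial, mul_smul, algebraMap_smul, hsmul]
      congr 1
      induction n with
      | zero => simp
      | succ n ih => rw [pow_succ', pow_succ', mul_smul, mul_smul, key, ih]
  obtain ⟨u, hu⟩ := hsurj (1, 0)
  have h := hpoly (minpoly (ZMod p) (m₁ / m₀)) u
  rw [minpoly.aeval, zero_smul, map_zero, hu] at h
  have h1 := congrArg Prod.fst h
  simp only [Prod.fst_zero, Prod.smul_fst, smul_eq_mul, mul_one] at h1
  have hint := Algebra.IsIntegral.isIntegral (R := ZMod p) (m₁ / m₀)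
  exact minpoly.eq_of_irreducible_of_monic (minpoly.irreducible hint) h1.symm
    (minpoly.monic hint)

end Heisenberg

namespace Heisenberg

/-! ### Counting parameters in each isomorphism class. -/

variable {p e : ℕ} [Fact p.Prime]

theorem index_cornerSubgroup_tracePerp (he : 2 ≤ e) {t : GaloisField p e}
    (ht : t ∉ Set.range (algebraMap (ZMod p) (GaloisField p e))) :
    (cornerSubgroup (tracePerp p t).toAddSubgroup).index = p ^ (2 * e + 2) := by
  have hp : 0 < p := (Fact.out : p.Prime).pos
  have he0 : e ≠ 0 := by omega
  have hcard : Nat.card (cornerSubgroup (tracePerp p t).toAddSubgroup) = p ^ (e - 2) := by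
    rw [card_cornerSubgroup]
    change Nat.card (tracePerp p t) = _
    rw [Module.natCard_eq_pow_finrank (K := ZMod p), finrank_tracePerp ht,
      GaloisField.finrank p he0, Nat.card_zmod]
  have h := (cornerSubgroup (tracePerp p t).toAddSubgroup).card_mul_index
  rw [hcard, Nat.card_congr (equivProd _), Nat.card_prod, Nat.card_prod,
    GaloisField.card p e he0] at h
  refine Nat.eq_of_mul_eq_mul_left (pow_pos hp (e - 2)) (h.trans ?_)
  rw [← pow_add, ← pow_add, ← pow_add]
  congr 1
  omega

/-- The member of the family attached to an element outside the prime field. -/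
noncomputable def kernelOf (he : 2 ≤ e)
    (t : {t : GaloisField p e // t ∉ Set.range (algebraMap (ZMod p) (GaloisField p e))}) :
    HeisenbergKernel p e where
  N := cornerSubgroup (tracePerp p t.1).toAddSubgroup
  le_commutator := cornerSubgroup_le_commutator _
  index_eq := index_cornerSubgroup_tracePerp he t.2

open Classical in
/-- The conjugates of `t`, transformed by fractional linear transformations over the prime
field. -/
noncomputable def relatives (t : GaloisField p e) : Finset (GaloisField p e) :=
  ((minpoly (ZMod p) t).aroots (GaloisField p e)).toFinset.biUnion fun x =>
    Finset.univ.image (fracLin p x)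

theorem card_relatives_le (he : e ≠ 0) (t : GaloisField p e) :
    (relatives t).card ≤ e * ((p - 1) * (p * (p + 1))) := by
  classical
  refine (Finset.card_biUnion_le_card_mul _ _ ((p - 1) * (p * (p + 1))) fun x _ => ?_).trans
    (Nat.mul_le_mul_right _ ?_)
  -- `p - 1` scalings, `p` translations and `p + 1` poles, with `none` as the pole at infinity.
  · refine Finset.card_image_le.trans_eq ?_
    rw [Finset.card_univ, Fintype.card_prod, Fintype.card_prod, Fintype.card_option,
      ZMod.card_units, ZMod.card]
  · refine (Multiset.toFinset_card_le _).trans ((Polynomial.card_roots' _).trans ?_)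
    rw [Polynomial.natDegree_map]
    exact (minpoly.natDegree_le t).trans_eq (GaloisField.finrank p he)

theorem mem_relatives {he : 2 ≤ e}
    {s t : {t : GaloisField p e // t ∉ Set.range (algebraMap (ZMod p) (GaloisField p e))}}
    (h : Nonempty ((kernelOf he s).Quot ≃* (kernelOf he t).Quot)) : s.1 ∈ relatives t.1 := by
  classical
  obtain ⟨f⟩ := h
  have : (cornerSubgroup (tracePerp p s.1).toAddSubgroup).Normal := (kernelOf he s).normal
  have : (cornerSubgroup (tracePerp p t.1).toAddSubgroup).Normal := (kernelOf he t).normal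
  obtain ⟨φ, χ, hsurj, hadd, hmem, hsymp⟩ :=
    exists_maps_of_mulEquiv (S := (tracePerp p s.1).toAddSubgroup)
      (T := (tracePerp p t.1).toAddSubgroup) f
  obtain ⟨m₀, hm₀, m₁, hm₁, hne, hmin⟩ := exists_minpoly_div_eq hsurj hadd hmem hsymp
  obtain ⟨g, hg⟩ := exists_fracLin_eq s.2 hm₀ hm₁ hne (notMem_range_of_minpoly_eq hmin t.2)
  refine Finset.mem_biUnion.mpr ⟨m₁ / m₀, ?_, Finset.mem_image.mpr ⟨g, Finset.mem_univ _, hg⟩⟩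
  rw [Multiset.mem_toFinset, Polynomial.mem_aroots, ← hmin]
  exact ⟨minpoly.ne_zero (Algebra.IsIntegral.isIntegral _), minpoly.aeval _ _⟩

theorem card_notMem_range (he : e ≠ 0) :
    Nat.card {t : GaloisField p e // t ∉ Set.range (algebraMap (ZMod p) (GaloisField p e))} =
      p ^ e - p := by
  have h := Set.ncard_add_ncard_compl (Set.range (algebraMap (ZMod p) (GaloisField p e)))
  rw [GaloisField.card p e he, ← Nat.card_coe_set_eq (Set.range _),
    Nat.card_range_of_injective (algebraMap (ZMod p) (GaloisField p e)).injective,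
    Nat.card_zmod] at h
  change (Set.range (algebraMap (ZMod p) (GaloisField p e)))ᶜ.ncard = _
  omega

instance : Finite (HeisenbergKernel p e) :=
  Finite.of_injective HeisenbergKernel.N fun K L h => by cases K; cases L; cases h; rfl

theorem pow_sub_le_mul_numIsoTypes (he : 2 ≤ e) :
    p ^ e - p ≤ e * ((p - 1) * (p * (p + 1))) * numIsoTypes p e := by
  classical
  have he0 : e ≠ 0 := by omega
  let T := {t : GaloisField p e // t ∉ Set.range (algebraMap (ZMod p) (GaloisField p e))}
  let : Fintype T := Fintype.ofFinite T
  let : Fintype (Quotient (heisenbergQuotientSetoid p e)) := Fintype.ofFinite _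
  rw [← card_notMem_range he0, numIsoTypes, Nat.card_eq_fintype_card, Nat.card_eq_fintype_card]
  refine Finset.card_le_mul_card_image_of_maps_to
    (f := fun t : T => (⟦kernelOf he t⟧ : Quotient (heisenbergQuotientSetoid p e)))
    (fun _ _ => Finset.mem_univ _) _ fun b _ => ?_
  obtain h | ⟨t, ht⟩ := Finset.eq_empty_or_nonempty
    {a ∈ (Finset.univ : Finset T) | (⟦kernelOf he a⟧ : Quotient (heisenbergQuotientSetoid p e)) = b}
  · rw [h]
    exact Nat.zero_le _
  · refine le_trans ?_ (card_relatives_le he0 t.1)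
    refine Finset.card_le_card_of_injOn Subtype.val (fun s hs => ?_) Subtype.val_injective.injOn
    have hs' := (Finset.mem_filter.mp hs).2
    rw [← (Finset.mem_filter.mp ht).2] at hs'
    exact mem_relatives (Quotient.exact hs')

end Heisenberg

theorem mainTheorem5 (p e : ℕ) [Fact p.Prime] (he : e.Prime) (hp2 : 2 < p) (he2 : 2 < e) :
    (p : ℝ) ^ ((e : ℤ) - 3) / (e : ℝ) ≤ (numIsoTypes p e : ℝ) := by
  have h := Heisenberg.pow_sub_le_mul_numIsoTypes (p := p) he2.le
  obtain ⟨k, rfl⟩ := Nat.exists_eq_add_of_le' (show 3 ≤ e from he2)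
  have hp1 : (2 : ℝ) < p := by exact_mod_cast hp2
  have hle : p ≤ p ^ (k + 3) := Nat.le_self_pow (by omega) p
  have h' : ((p ^ (k + 3) - p : ℕ) : ℝ) ≤
      (((k + 3) * ((p - 1) * (p * (p + 1))) * numIsoTypes p (k + 3) : ℕ) : ℝ) := by
    exact_mod_cast h
  generalize numIsoTypes p (k + 3) = n at *
  rw [Nat.cast_sub hle] at h'
  push_cast [Nat.cast_sub (show 1 ≤ p by omega)] at h' ⊢
  rw [show (k : ℤ) + 3 - 3 = (k : ℤ) by ring, zpow_natCast, div_le_iff₀ (by positivity)]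
  have hk : (1 : ℝ) ≤ (p : ℝ) ^ k := one_le_pow₀ (by linarith)
  have hpos : (0 : ℝ) < ((p : ℝ) - 1) * (p * (p + 1)) :=
    mul_pos (by linarith) (by positivity)
  refine le_of_mul_le_mul_right ?_ hpos
  -- Since `p ≤ p ^ (k + 1)`, the parameter count `p ^ (k + 3) - p` is at least `p ^ k * (p ^ 3 -
  -- p)`.
  have h3 : (p : ℝ) * 1 ≤ p * p ^ k := mul_le_mul_of_nonneg_left hk (by linarith)
  calc (p : ℝ) ^ k * ((p - 1) * (p * (p + 1))) = p ^ (k + 3) - p * p ^ k := by ring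
    _ ≤ p ^ (k + 3) - p := by linarith
    _ ≤ _ := h'
    _ = _ := by ring
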